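/- **Setting.** Let \((\epsilon_t)_{t\in\mathbb Z}\) be a Gaussian white noise (i.i.d. \(N(0,1)\)), let \(\mu\in\mathbb R\) and \((\psi_k)_{k\ge 0}\in\ell^2\) be real, and let market demand be \(D_t=\mu+\sum_{k\ge 0}\psi_k\epsilon_{t-k}\) (convergence in mean square), \(t\in\mathbb Z\). Assume that \((D_t)\) is invertible with respect to \((\epsilon_t)\): every \(\epsilon_t\) is a mean-square limit of finite linear combinations of \(D_s-\mu\), \(s\le t\). Put \(\psi(z)=\sum_{k\ge0}\psi_kz^k\) for \(|z|<1\). An allocation policy \(\pi\) among \(N\) sellers consists of means \(\mu_n\) and square-summable real sequences \((\tau_{nk})_{k\ge0}\), with transfer functions \(\tau_n(z)=\sum_k\tau_{nk}z^k\), \(n=1,\dots,N\). Seller \(n\)'s demand is \(D_{nt}=\mu_n+\sum_{k\ge0}\tau_{nk}(D_{t-k}-\mu)\) (in mean square), and its \(z\)-transform is \(\psi_n(z)=\tau_n(z)\psi(z)\). The policy is *admissible* if these demands are well defined, \(\sum_n\mu_n=\mu\), \(\sum_n\tau_n(z)=1\) for \(|z|<1\), and \(\sum_nD_{nt}=D_t\)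 a.s. for all \(t\). Seller \(n\)'s one-step-ahead root mean squared forecast error (MSFE) \(\sigma_n^\pi\ge 0\) is defined by \((\sigma_n^\pi)^2=\operatorname{Var}\bigl[D_{n,t+1}-m_{nt}\mid\mathcal F_{nt}\bigr]\), where \(\mathcal F_{nt}\) is the \(\sigma\)-algebra generated by \((D_{ns})_{s\le t}\) and \(m_{nt}=\mathbb E[D_{n,t+1}\mid\mathcal F_{nt}]\) (the conditional variance being a.s. the same constant for all \(t\)). An admissible policy is *neutral* if \(\mu_n=\mu/N\) for all \(n\) and all \(\sigma_n^\pi\) equal one common constant \(\sigma^\pi>0\). Let \(\sigma_L=|\psi(0)|/N\). **Proposition.** Let \(N\ge 2\) be even, let \(\sigma>\sigma_L\), and put \(\bar\alpha=\sigma/\sigma_L=N\sigma/|\psi(0)|\). There is an allocation policy with \(\mu_n=\mu/N\) and \[ \psi_n(z)=\frac{\psi(z)}{N}\bigl(1+(-1)^n\,\bar\alpha\,z\bigr),\qquad |z|<1,\quad n=1,\dots,N, \] and every such policy \(\pi\) is admissible and neutral, and satisfies \(\sigma_n^\pi=\sigma\) for every seller \(n\), that is, \(\sigma^\pi=\sigma\).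 -/

import Mathlib

open MeasureTheory ProbabilityTheory Filter Topology
open scoped ENNReal

/-- The series `∑ₖ f k` of random variables converges to `S` in mean square. -/
def MeanSquareSum {Ω : Type*} [MeasurableSpace Ω] (P : Measure Ω)
    (f : ℕ → Ω → ℝ) (S : Ω → ℝ) : Prop :=
  Tendsto (fun m : ℕ => eLpNorm (fun ω => S ω - ∑ k ∈ Finset.range m, f k ω) 2 P) atTop (𝓝 0)

/-- Gaussian white noise with unit variance. -/
structure IsGaussianWhiteNoise {Ω : Type*} [MeasurableSpace Ω] (P : Measure Ω)
    (ε : ℤ → Ω → ℝ) : Prop where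
  measurable : ∀ t, Measurable (ε t)
  indep : iIndepFun ε P
  law : ∀ t, P.map (ε t) = gaussianReal 0 1

/-- The process `D` with mean `μ` is invertible with respect to the shocks `ε`: each shock `ε t`
is recovered from the present and past of `D`, as a mean-square limit of finite linear
combinations of `D t - μ, D (t - 1) - μ, …`. In particular this holds whenever
`ε t = ∑ₖ ϖ k * (D (t - k) - μ)` in mean square for some fixed coefficients `ϖ`. -/
def IsInvertible {Ω : Type*} [MeasurableSpace Ω] (P : Measure Ω)
    (μ : ℝ) (D ε : ℤ → Ω → ℝ) : Prop :=
  ∀ t : ℤ, ∀ δ : ℝ≥0∞, 0 < δ → ∃ (m : ℕ) (c : ℕ → ℝ),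
    eLpNorm (fun ω => ε t ω - ∑ k ∈ Finset.range m, c k * (D (t - k) ω - μ)) 2 P < δ

/-- Market demand: `D t = μ + ∑ₖ ψ k * ε (t - k)` with `ψ ∈ ℓ²` and `ε` a unit-variance Gaussian
white noise, invertible with respect to `ε`. -/
structure IsMarketDemand {Ω : Type*} [MeasurableSpace Ω] (P : Measure Ω)
    (μ : ℝ) (ψ : ℕ → ℝ) (ε D : ℤ → Ω → ℝ) : Prop where
  whiteNoise : IsGaussianWhiteNoise P ε
  sq_summable : Summable fun k => ψ k ^ 2
  measurable : ∀ t, Measurable (D t)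
  movingAverage : ∀ t : ℤ,
    MeanSquareSum P (fun k ω => ψ k * ε (t - k) ω) (fun ω => D t ω - μ)
  invertible : IsInvertible P μ D ε

/-- The `z`-transform `∑ₖ a k * z ^ k`; it is used for `|z| < 1` and square-summable `a`, where
the series converges absolutely. -/
noncomputable def zTransform (a : ℕ → ℝ) (z : ℂ) : ℂ := ∑' k : ℕ, (a k : ℂ) * z ^ k

/-- A linear demand allocation among `N` sellers: a mean and a square-summable causal filter for
each seller. Market clearing is part of `IsAdmissible`. -/
structure AllocationPolicy (N : ℕ) where
  mean : Fin N → ℝ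
  filter : Fin N → ℕ → ℝ
  sq_summable : ∀ n, Summable fun k => filter n k ^ 2

/-- `X` is the demand process of seller `n` under the policy `π`:
`X t = mean n + ∑ₖ filter n k * (D (t - k) - μ)` in mean square. -/
structure IsSellerDemand {Ω : Type*} [MeasurableSpace Ω] (P : Measure Ω)
    (μ : ℝ) (D : ℤ → Ω → ℝ) {N : ℕ} (π : AllocationPolicy N) (n : Fin N)
    (X : ℤ → Ω → ℝ) : Prop where
  measurable : ∀ t, Measurable (X t)
  eq_filter : ∀ t : ℤ,
    MeanSquareSum P (fun k ω => π.filter n k * (D (t - k) ω - μ)) (fun ω => X t ω - π.mean n)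

/-- The `z`-transform of seller `n`'s demand: transfer function times market transform. -/
noncomputable def sellerTransform (ψ : ℕ → ℝ) {N : ℕ} (π : AllocationPolicy N) (n : Fin N)
    (z : ℂ) : ℂ :=
  zTransform (π.filter n) z * zTransform ψ z

/-- Admissibility: all seller demands are well defined, the means add up to `μ`, the transfer
functions add up to `1` on the unit disk, and the market clears in every period. -/
structure IsAdmissible {Ω : Type*} [MeasurableSpace Ω] (P : Measure Ω)
    (μ : ℝ) (D : ℤ → Ω → ℝ) {N : ℕ} (π : AllocationPolicy N) : Prop where
  exists_demand : ∀ n, ∃ X, IsSellerDemand P μ D π n X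
  sum_mean : ∑ n, π.mean n = μ
  sum_transfer : ∀ z : ℂ, ‖z‖ < 1 → ∑ n, zTransform (π.filter n) z = 1
  clearing : ∀ X : Fin N → ℤ → Ω → ℝ, (∀ n, IsSellerDemand P μ D π n (X n)) →
    ∀ t, D t =ᵐ[P] fun ω => ∑ n, X n t ω

/-- The information at time `t`: the σ-algebra generated by `X s`, `s ≤ t`. -/
abbrev history {Ω : Type*} (X : ℤ → Ω → ℝ) (t : ℤ) : MeasurableSpace Ω :=
  ⨆ s : ℤ, ⨆ _ : s ≤ t, MeasurableSpace.comap (X s) inferInstance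

/-- `σ ≥ 0` is the one-step-ahead root mean squared forecast error of the square-integrable
process `X`: with `m t = E[X (t + 1) | X s, s ≤ t]`, the conditional variance of
`X (t + 1) - m t` given the history up to `t` is almost surely `σ ^ 2`, for every `t`. -/
def HasRootMSFE {Ω : Type*} [MeasurableSpace Ω] (P : Measure Ω)
    (X : ℤ → Ω → ℝ) (σ : ℝ) : Prop :=
  0 ≤ σ ∧ (∀ t, Measurable (X t) ∧ MemLp (X t) 2 P) ∧
    ∀ t : ℤ, condVar (history X t) (X (t + 1) - P[X (t + 1) | history X t]) P
      =ᵐ[P] fun _ => σ ^ 2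

/-- Seller `n` has root MSFE `σ` under the policy `π`. Seller `n`'s demand is determined up to
almost sure equality, and the property is required of every version. -/
def SellerHasRootMSFE {Ω : Type*} [MeasurableSpace Ω] (P : Measure Ω)
    (μ : ℝ) (D : ℤ → Ω → ℝ) {N : ℕ} (π : AllocationPolicy N) (n : Fin N) (σ : ℝ) : Prop :=
  (∃ X, IsSellerDemand P μ D π n X) ∧ ∀ X, IsSellerDemand P μ D π n X → HasRootMSFE P X σ

/-- Neutrality: the policy is admissible, all sellers have mean `μ / N`, and all sellers have the
same positive root MSFE. -/
def IsNeutral {Ω : Type*} [MeasurableSpace Ω] (P : Measure Ω)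
    (μ : ℝ) (D : ℤ → Ω → ℝ) {N : ℕ} (π : AllocationPolicy N) : Prop :=
  IsAdmissible P μ D π ∧
    ∃ σ : ℝ, 0 < σ ∧ ∀ n, π.mean n = μ / N ∧ SellerHasRootMSFE P μ D π n σ

/-- The benchmark `σ_L = |ψ₀| / N`. -/
noncomputable def sigmaL (ψ : ℕ → ℝ) (N : ℕ) : ℝ := |ψ 0| / N

/-- Every seller has mean `μ / N`, and for `|z| < 1` the `z`-transform of the demand of seller
number `n ∈ {1, …, N}` is `ψ(z) / N * (1 + (-1) ^ n * α * z)`. The index `i : Fin N` stands for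
the seller with number `i + 1`. -/
def IsAlternatingPolicy (μ : ℝ) (ψ : ℕ → ℝ) {N : ℕ} (α : ℝ) (π : AllocationPolicy N) : Prop :=
  ∀ i : Fin N, π.mean i = μ / N ∧ ∀ z : ℂ, ‖z‖ < 1 →
    sellerTransform ψ π i z = zTransform ψ z / N * (1 + (-1) ^ ((i : ℕ) + 1) * (α : ℂ) * z)

/-!
A transfer function `τ` with `τ(z) ψ(z) = ψ(z) (1 + s α z) / N`, where `s = ±1` and
`α = σ / σ_L`, must be `(1 + s α z) / N`, because `ψ(0) ≠ 0`: if `ψ(0)` vanished, the present and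
past of demand would be orthogonal to the current shock, against invertibility
(`IsMarketDemand.leading_ne_zero`, `isAlternatingPolicy_iff`). Seller demand is then
`μ / N + (d t + s α d (t - 1)) / N` with `d = D - μ`. For an even number of sellers the signs cancel
in the sum, which gives admissibility.

The forecast error comes from a Blaschke factor. Since `α > 1`, the polynomial `1 + s α z` has its
zero inside the unit disk, while `α + s z` has none in the closed disk, and
`|1 + s α z| = |α + s z|` on the unit circle. So the shocks filtered by
`(1 + s α z) / (α + s z)` are again white noise, and with respect to them seller demand has the
invertible transfer function `ψ(z) (α + s z) / N`; its one-step innovation has standard deviation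
`|ψ(0)| α / N = σ`. In Hilbert space terms, with the backward shift `S` as an isometry in place of
`z`, the two facts needed are the identity
`⟪(1 + s α S) a, (1 + s α S) b⟫ = ⟪(α + s S) a, (α + s S) b⟫` (`inner_add_smul_isometry`) and the
surjectivity of `α + s S` on the closed span of the past
(`exists_mem_smul_add_smul_isometry_eq`). They yield a linear predictor in the closed span of the
seller's own past whose error has norm `σ` and is orthogonal to that past (`exists_innovation`).

The mean-square closure of the span of the shocks consists of centered Gaussian variables
(`IsGaussianWhiteNoise.span_subset_centeredGaussian`). Orthogonality within it is independence,
hence the linear predictor is the conditional expectation and the conditional variance of the error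
is the constant `σ ^ 2` (`hasRootMSFE_of_innovation`).
-/

/-! ### Prediction of a moving average in a Hilbert space -/

section Hilbert

variable {G : Type*} [NormedAddCommGroup G] [InnerProductSpace ℝ G]

/-- `∑ₖ ψ k δ (t - k)` converges to `x t` for every `t`. -/
def IsMovingAverage (ψ : ℕ → ℝ) (δ x : ℤ → G) : Prop :=
  ∀ t : ℤ, Tendsto (fun m : ℕ => ∑ k ∈ Finset.range m, ψ k • δ (t - k)) atTop (𝓝 (x t))

/-- The closed linear span of the present and past `x s`, `s ≤ t`. -/
def closedPast (x : ℤ → G) (t : ℤ) : Submodule ℝ G :=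
  (Submodule.span ℝ (x '' Set.Iic t)).topologicalClosure

lemma closedPast_isClosed (x : ℤ → G) (t : ℤ) : IsClosed (closedPast x t : Set G) :=
  Submodule.isClosed_topologicalClosure _

lemma mem_closedPast (x : ℤ → G) {s t : ℤ} (h : s ≤ t) : x s ∈ closedPast x t :=
  Submodule.le_topologicalClosure _ (Submodule.subset_span ⟨s, h, rfl⟩)

lemma closedPast_le {x : ℤ → G} {t : ℤ} {K : Submodule ℝ G} (hK : IsClosed (K : Set G))
    (h : ∀ s ≤ t, x s ∈ K) : closedPast x t ≤ K :=
  Submodule.topologicalClosure_minimal _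
    (Submodule.span_le.2 (by rintro _ ⟨s, hs, rfl⟩; exact h s hs)) hK

lemma closedPast_mono (x : ℤ → G) {s t : ℤ} (h : s ≤ t) : closedPast x s ≤ closedPast x t :=
  closedPast_le (closedPast_isClosed x t) fun _ hr => mem_closedPast x (hr.trans h)

lemma map_mem_of_mem_closedPast {H : Type*} [NormedAddCommGroup H] [InnerProductSpace ℝ H]
    (A : G →L[ℝ] H) {x : ℤ → G} {t : ℤ} {K : Submodule ℝ H} (hK : IsClosed (K : Set H))
    (h : ∀ s ≤ t, A (x s) ∈ K) {a : G} (ha : a ∈ closedPast x t) : A a ∈ K :=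
  closedPast_le (K := K.comap (A : G →ₗ[ℝ] H)) (hK.preimage A.continuous) h ha

lemma inner_eq_zero_of_mem_closedPast {x : ℤ → G} {t : ℤ} {w : G}
    (h : ∀ s ≤ t, inner ℝ w (x s) = 0) {a : G} (ha : a ∈ closedPast x t) : inner ℝ w a = 0 := by
  have := map_mem_of_mem_closedPast (innerSL ℝ w) (K := (⊥ : Submodule ℝ ℝ))
    (by simp) (by simpa using h) ha
  simpa using this

namespace IsMovingAverage

variable {ψ : ℕ → ℝ} {δ x : ℤ → G}

lemma mem_closedPast (h : IsMovingAverage ψ δ x) (t : ℤ) : x t ∈ closedPast δ t := by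
  refine (closedPast_isClosed δ t).mem_of_tendsto (h t) (Eventually.of_forall fun m => ?_)
  exact Submodule.sum_mem _ fun k _ => Submodule.smul_mem _ _ (_root_.mem_closedPast δ (by lia))

lemma sub_mem_closedPast (h : IsMovingAverage ψ δ x) (t : ℤ) :
    x (t + 1) - ψ 0 • δ (t + 1) ∈ closedPast δ t := by
  have h1 := ((h (t + 1)).comp (tendsto_add_atTop_nat 1)).sub_const (ψ 0 • δ (t + 1))
  refine (closedPast_isClosed δ t).mem_of_tendsto h1 (Eventually.of_forall fun m => ?_)
  simp only [Function.comp, Finset.sum_range_succ', Nat.cast_zero, sub_zero, add_sub_cancel_right]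
  exact Submodule.sum_mem _ fun k _ => Submodule.smul_mem _ _
    (_root_.mem_closedPast δ (by push_cast; lia))

lemma map_shift (h : IsMovingAverage ψ δ x) (S : G →ₗᵢ[ℝ] G) (hS : ∀ t, S (δ t) = δ (t - 1))
    (t : ℤ) : S (x t) = x (t - 1) := by
  have h1 := (S.continuous.tendsto _).comp (h t)
  refine tendsto_nhds_unique h1 ?_
  convert h (t - 1) using 2 with m
  simp only [Function.comp, map_sum, map_smul, hS]
  refine Finset.sum_congr rfl fun k _ => ?_
  congr 2; ring

/-- A process that is invertible with respect to its shocks has a nonzero leading coefficient: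
otherwise every `x s`, `s ≤ t`, would be orthogonal to the shock `δ t`. -/
lemma leading_ne_zero (h : IsMovingAverage ψ δ x) (hδ : Orthonormal ℝ δ)
    (hinv : ∀ t, δ t ∈ closedPast x t) : ψ 0 ≠ 0 := by
  intro h0
  have h1 : inner ℝ (δ 0) (δ 0) = 0 := by
    refine inner_eq_zero_of_mem_closedPast (fun s hs => ?_) (hinv 0)
    have h2 := h.sub_mem_closedPast (s - 1)
    rw [h0, zero_smul, sub_zero, sub_add_cancel] at h2
    exact inner_eq_zero_of_mem_closedPast (fun r hr => hδ.2 (by lia)) h2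
  rw [real_inner_self_eq_norm_sq, hδ.1] at h1
  norm_num at h1

end IsMovingAverage

/-- The identity `|1 + s α z| = |α + s z|` on the unit circle, for the isometry `S` in place of
`z`. -/
lemma inner_add_smul_isometry (S : G →ₗᵢ[ℝ] G) {s : ℝ} (hs : s ^ 2 = 1) (α : ℝ) (a b : G) :
    inner ℝ (a + (s * α) • S a) (b + (s * α) • S b) =
      inner ℝ (α • a + s • S a) (α • b + s • S b) := by
  simp only [inner_add_left, inner_add_right, real_inner_smul_left, real_inner_smul_right,
    S.inner_map_map]
  linear_combination (α ^ 2 - 1) * inner ℝ a b * hs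

/-- `α + s S` is surjective for an isometry `S` and `|s| = 1 < α`, by the Neumann series. -/
lemma exists_smul_add_smul_isometry_eq [CompleteSpace G] (S : G →ₗᵢ[ℝ] G) {s α : ℝ}
    (hs : s ^ 2 = 1) (hα : 1 < α) (k : G) : ∃ a, α • a + s • S a = k := by
  have hα0 : α ≠ 0 := by positivity
  have hsabs : |s| = 1 := by rw [← abs_one, ← sq_eq_sq_iff_abs_eq_abs, hs, one_pow]
  let R : G →L[ℝ] G := (-(s / α)) • S.toContinuousLinearMap
  have hR : ‖R‖ < 1 := by
    refine (ContinuousLinearMap.opNorm_le_bound R (M := α⁻¹) (by positivity) fun a => ?_).trans_lt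
      (inv_lt_one_of_one_lt₀ hα)
    simp [R, norm_smul, hsabs, abs_of_pos (show 0 < α by linarith)]
  obtain ⟨u, hu⟩ := isUnit_one_sub_of_norm_lt_one hR
  refine ⟨(↑u⁻¹ : G →L[ℝ] G) (α⁻¹ • k), ?_⟩
  have h1 : (u : G →L[ℝ] G) ((↑u⁻¹ : G →L[ℝ] G) (α⁻¹ • k)) = α⁻¹ • k := by
    simp only [← mul_apply_eq_comp, Units.mul_inv, one_apply_eq_self]
  rw [hu] at h1
  have h2 := congrArg (fun b : G => α • b) h1
  simpa [R, smul_smul, smul_sub, hα0, div_eq_mul_inv] using h2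

/-- `α + s S` is surjective on closed `S`-invariant subspaces. -/
lemma exists_mem_smul_add_smul_isometry_eq [CompleteSpace G] (S : G →ₗᵢ[ℝ] G) {s α : ℝ}
    (hs : s ^ 2 = 1) (hα : 1 < α) {K : Submodule ℝ G} (hK : IsClosed (K : Set G))
    (hSK : ∀ a ∈ K, S a ∈ K) {k : G} (hk : k ∈ K) : ∃ a ∈ K, α • a + s • S a = k := by
  have : CompleteSpace K := hK.completeSpace_coe
  let SK : K →ₗᵢ[ℝ] K := ⟨S.toLinearMap.restrict hSK, fun a => S.norm_map a⟩
  obtain ⟨a, ha⟩ := exists_smul_add_smul_isometry_eq SK hs hα ⟨k, hk⟩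
  exact ⟨a, a.2, congrArg Subtype.val ha⟩

/-- One-step prediction of `y t = κ (x t + s α x (t - 1))`, where `x` is the invertible moving
average with coefficients `ψ` of the orthonormal shocks `δ`: the projection of `y (t + 1)` on the
closed past of `y` leaves an error of norm `|κ| α |ψ 0|`. -/
lemma exists_innovation [CompleteSpace G] {ψ : ℕ → ℝ} {δ x : ℤ → G} (hδ : Orthonormal ℝ δ)
    (hx : IsMovingAverage ψ δ x) (hinv : ∀ t, δ t ∈ closedPast x t)
    (S : G →ₗᵢ[ℝ] G) (hS : ∀ t, S (δ t) = δ (t - 1)) {s α : ℝ} (hs : s ^ 2 = 1) (hα : 1 < α)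
    (κ : ℝ) {y : ℤ → G} (hy : ∀ t, y t = κ • (x t + (s * α) • x (t - 1))) (t : ℤ) :
    ∃ p ∈ closedPast y t, ‖y (t + 1) - p‖ = |κ| * α * |ψ 0| ∧
      ∀ r ≤ t, inner ℝ (y (t + 1) - p) (y r) = 0 := by
  have hSx := hx.map_shift S hS
  have hKS : ∀ a ∈ closedPast x t, S a ∈ closedPast x t := fun a ha =>
    map_mem_of_mem_closedPast S.toContinuousLinearMap (closedPast_isClosed x t)
      (fun r hr => by
        simpa [hSx] using mem_closedPast x (show r - 1 ≤ t by lia)) ha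
  have hpast : closedPast δ t ≤ closedPast x t := closedPast_le (closedPast_isClosed x t)
    fun r hr => closedPast_mono x hr (hinv r)
  -- `q` solves `(α + s S) (x (t + 1) - q) = α ψ₀ δ (t + 1)`, so that `(1 + s α S) (x (t + 1) - q)`
  -- is a multiple of the Blaschke factor `(1 + s α S) / (α + s S)` applied to `δ (t + 1)`
  obtain ⟨q, hqK, hq⟩ := exists_mem_smul_add_smul_isometry_eq S hs hα (closedPast_isClosed x t) hKS
    (k := α • (x (t + 1) - ψ 0 • δ (t + 1)) + s • x t)
    (Submodule.add_mem _ (Submodule.smul_mem _ _ (hpast (hx.sub_mem_closedPast t)))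
      (Submodule.smul_mem _ _ (mem_closedPast x le_rfl)))
  have hw : α • (x (t + 1) - q) + s • S (x (t + 1) - q) = (α * ψ 0) • δ (t + 1) := by
    rw [map_sub, hSx, add_sub_cancel_right]
    calc _ = α • x (t + 1) + s • x t - (α • q + s • S q) := by module
      _ = _ := by rw [hq]; module
  have hyA : ∀ r, y r = κ • (x r + (s * α) • S (x r)) := fun r => by rw [hy, hSx]
  have hyw : y (t + 1) - κ • (q + (s * α) • S q) =
      κ • ((x (t + 1) - q) + (s * α) • S (x (t + 1) - q)) := by
    rw [hyA, map_sub]; module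
  refine ⟨κ • (q + (s * α) • S q), ?_, ?_, fun r hr => ?_⟩
  · let A : G →L[ℝ] G := κ • (1 + (s * α) • S.toContinuousLinearMap)
    refine map_mem_of_mem_closedPast A (closedPast_isClosed y t) (fun r hr => ?_) hqK
    convert mem_closedPast y hr using 1
    simp [A, hyA]
  · have h1 := inner_add_smul_isometry S hs α (x (t + 1) - q) (x (t + 1) - q)
    rw [hw, real_inner_self_eq_norm_sq, real_inner_self_eq_norm_sq,
      sq_eq_sq₀ (norm_nonneg _) (norm_nonneg _)] at h1
    rw [hyw, norm_smul, h1, norm_smul, hδ.1, Real.norm_eq_abs, Real.norm_eq_abs, abs_mul,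
      abs_of_pos (show 0 < α by linarith)]
    ring
  · rw [hyw, hyA, real_inner_smul_left, real_inner_smul_right, inner_add_smul_isometry S hs, hw,
      real_inner_smul_left, inner_add_right, real_inner_smul_right, real_inner_smul_right, hSx]
    have h0 : ∀ r ≤ t, inner ℝ (δ (t + 1)) (x r) = 0 := fun r hr =>
      inner_eq_zero_of_mem_closedPast (fun j hj => hδ.2 (by lia)) (hx.mem_closedPast r)
    rw [h0 r hr, h0 (r - 1) (by lia)]
    ring

/-- `exists_innovation` without a given shift: it is proved in `ℓ²(ℤ)`, where the standard unit
vectors carry a shift, and transported by the isometry of `ℓ²(ℤ)` onto the closed span of the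
shocks. -/
lemma exists_innovation_of_orthonormal {H : Type*} [NormedAddCommGroup H] [InnerProductSpace ℝ H]
    [CompleteSpace H] {ψ : ℕ → ℝ} {δ x : ℤ → H} (hδ : Orthonormal ℝ δ)
    (hx : IsMovingAverage ψ δ x) (hinv : ∀ t, δ t ∈ closedPast x t)
    {s α : ℝ} (hs : s ^ 2 = 1) (hα : 1 < α)
    (κ : ℝ) {y : ℤ → H} (hy : ∀ t, y t = κ • (x t + (s * α) • x (t - 1))) (t : ℤ) :
    ∃ p ∈ closedPast y t, ‖y (t + 1) - p‖ = |κ| * α * |ψ 0| ∧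
      ∀ r ≤ t, inner ℝ (y (t + 1) - p) (y r) = 0 := by
  let V : lp (fun _ : ℤ => ℝ) 2 →ₗᵢ[ℝ] H := hδ.orthogonalFamily.linearIsometry
  let e : ℤ → lp (fun _ : ℤ => ℝ) 2 := fun t => lp.single 2 t 1
  have hV : ∀ t, V (e t) = δ t := fun t => by
    simp only [V, e, OrthogonalFamily.linearIsometry_apply_single]
    simp
  have hinj : Function.Injective V := V.injective
  have he : Orthonormal ℝ e := by
    rw [← V.orthonormal_comp_iff]
    convert hδ using 1
    ext t; exact hV t
  -- the backward shift on `ℓ²(ℤ)`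
  have heS : Orthonormal ℝ (fun t => e (t - 1)) := he.comp _ (sub_left_injective)
  let S : lp (fun _ : ℤ => ℝ) 2 →ₗᵢ[ℝ] lp (fun _ : ℤ => ℝ) 2 :=
    heS.orthogonalFamily.linearIsometry
  have hS : ∀ t, S (e t) = e (t - 1) := fun t => by
    have := heS.orthogonalFamily.linearIsometry_apply_single (i := t) (1 : ℝ)
    refine this.trans ?_
    simp
  have hclosed : IsClosed (V.toLinearMap.range : Set H) := by
    convert V.isometry.isClosedEmbedding.isClosed_range
    ext; simp
  have hmem : ∀ t, ∃ a, V a = x t := fun t => by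
    refine hclosed.mem_of_tendsto (hx t) (Eventually.of_forall fun m => ?_)
    refine ⟨∑ k ∈ Finset.range m, ψ k • e (t - k), ?_⟩
    simp [hV]
  choose a ha using hmem
  have hxa : IsMovingAverage ψ e a := fun t => by
    rw [V.isometry.isEmbedding.tendsto_nhds_iff, ha]
    convert hx t using 2 with m
    simp [hV]
  have hpast : ∀ t, closedPast x t ≤ (closedPast a t).map V.toLinearMap := fun t => by
    refine closedPast_le ?_ fun r hr => ⟨a r, mem_closedPast a hr, ha r⟩
    simpa using V.isometry.isClosedEmbedding.isClosedMap _ (closedPast_isClosed a t)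
  have hinv' : ∀ t, e t ∈ closedPast a t := fun t => by
    obtain ⟨b, hb, hbe⟩ := hpast t (hinv t)
    have : b = e t := hinj (hbe.trans (hV t).symm)
    exact this ▸ hb
  obtain ⟨p, hp, hnorm, horth⟩ := exists_innovation he hxa hinv' S hS hs hα κ
    (y := fun t => κ • (a t + (s * α) • a (t - 1))) (fun _ => rfl) t
  have hVy : ∀ t, V (κ • (a t + (s * α) • a (t - 1))) = y t := fun t => by
    simp [hy, ha]
  refine ⟨V p, ?_, ?_, fun r hr => ?_⟩
  · exact map_mem_of_mem_closedPast V.toContinuousLinearMap (closedPast_isClosed y t)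
      (fun r hr => (hVy r).symm ▸ mem_closedPast y hr) hp
  · rw [← hVy, ← map_sub, V.norm_map, hnorm]
  · rw [← hVy, ← hVy r, ← map_sub, V.inner_map_map, horth r hr]

end Hilbert

/-! ### Gaussian spaces and conditional variance -/

section GaussianSpace

lemma measurable_history {Ω : Type*} (X : ℤ → Ω → ℝ) {s t : ℤ} (h : s ≤ t) :
    Measurable[history X t] (X s) :=
  (comap_measurable (X s)).mono (le_iSup₂_of_le s h le_rfl) le_rfl

variable {Ω : Type*} [MeasurableSpace Ω] {P : Measure Ω}

lemma coeFn_sum_smul {ι : Type*} (I : Finset ι) (c : ι → ℝ) {F : ι → Lp ℝ 2 P} {f : ι → Ω → ℝ}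
    (h : ∀ i, F i =ᵐ[P] f i) :
    ⇑(∑ i ∈ I, c i • F i) =ᵐ[P] fun ω => ∑ i ∈ I, c i * f i ω := by
  have h2 : ∀ᵐ ω ∂P, ∀ i ∈ I, (c i • F i : Lp ℝ 2 P) ω = c i * f i ω :=
    (Finset.eventually_all I).2 fun i _ => by
      filter_upwards [Lp.coeFn_smul (c i) (F i), h i] with ω h1 h2
      rw [h1, Pi.smul_apply, h2, smul_eq_mul]
  filter_upwards [Lp.coeFn_finsetSum I fun i => c i • F i, h2] with ω h1 h2
  rw [h1, Finset.sum_apply]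
  exact Finset.sum_congr rfl h2

lemma integral_mul_eq_inner (f g : Lp ℝ 2 P) : ∫ ω, f ω * g ω ∂P = inner ℝ f g := by
  simp [L2.inner_def, mul_comm]

lemma integral_sq_eq_norm_sq (f : Lp ℝ 2 P) : ∫ ω, f ω ^ 2 ∂P = ‖f‖ ^ 2 := by
  rw [← real_inner_self_eq_norm_sq, ← integral_mul_eq_inner]
  simp_rw [pow_two]

/-- The square-integrable variables that are centered Gaussian, possibly degenerate. -/
def centeredGaussian (P : Measure Ω) : Set (Lp ℝ 2 P) :=
  {f | HasGaussianLaw f P ∧ ∫ ω, f ω ∂P = 0}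

/-- In a linear space of centered Gaussian variables, every family is jointly Gaussian. -/
lemma isGaussianProcess_of_subset_centeredGaussian {K : Submodule ℝ (Lp ℝ 2 P)}
    (hK : (K : Set (Lp ℝ 2 P)) ⊆ centeredGaussian P) {T : Type*} {F : T → Lp ℝ 2 P}
    (hF : ∀ t, F t ∈ K) : IsGaussianProcess (fun t ω => F t ω) P where
  hasGaussianLaw I := by
    classical
    have hmeas : AEMeasurable (fun ω => I.restrict (fun t => F t ω)) P :=
      aemeasurable_pi_lambda _ fun i => (Lp.aestronglyMeasurable (F i)).aemeasurable
    refine ⟨⟨fun L => ?_⟩⟩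
    let g : Lp ℝ 2 P := ∑ i : I, L (Pi.single i 1) • F i
    have hg : g ∈ centeredGaussian P :=
      hK (Submodule.sum_mem _ fun i _ => Submodule.smul_mem _ _ (hF i))
    have hLg : g =ᵐ[P] fun ω => L (I.restrict (fun t => F t ω)) := by
      filter_upwards [coeFn_sum_smul Finset.univ (fun i : I => L (Pi.single i 1))
        fun i : I => ae_eq_refl (F i)] with ω h
      refine h.trans (Eq.trans ?_ (LinearMap.pi_apply_eq_sum_univ (L : (I → ℝ) →ₗ[ℝ] ℝ) _).symm)
      simp only [smul_eq_mul, ContinuousLinearMap.coe_coe, Finset.restrict]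
      refine Finset.sum_congr rfl fun i _ => ?_
      rw [mul_comm]
      congr 3
      ext j
      simp [Pi.single_apply, eq_comm]
    have := (hg.1.congr hLg).isGaussian_map
    rw [AEMeasurable.map_map_of_aemeasurable (by fun_prop) hmeas]
    have h3 := (hg.1.congr hLg).map_eq_gaussianReal
    rw [integral_map hmeas (by fun_prop), variance_map (by fun_prop) hmeas]
    exact h3

lemma history_le {X : ℤ → Ω → ℝ} (hX : ∀ t, Measurable (X t)) (t : ℤ) :
    history X t ≤ (inferInstance : MeasurableSpace Ω) :=
  iSup₂_le fun s _ => (hX s).comap_le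

variable [IsProbabilityMeasure P]

lemma integral_norm_le_norm (f : Lp ℝ 2 P) : ∫ ω, ‖f ω‖ ∂P ≤ ‖f‖ := by
  have h := Lp.memLp f
  rw [integral_norm_eq_lintegral_enorm h.1, Lp.norm_def, ← eLpNorm_one_eq_lintegral_enorm]
  exact ENNReal.toReal_mono h.2.ne (eLpNorm_le_eLpNorm_of_exponent_le (by norm_num) h.1)

lemma continuous_integral_Lp_two : Continuous fun f : Lp ℝ 2 P => ∫ ω, f ω ∂P := by
  refine (LipschitzWith.of_dist_le_mul (K := 1) fun f g => ?_).continuous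
  have hint : ∀ f : Lp ℝ 2 P, Integrable f P := fun f => (Lp.memLp f).integrable (by norm_num)
  rw [dist_eq_norm, dist_eq_norm, ← integral_sub (hint f) (hint g), NNReal.coe_one, one_mul]
  calc _ = ‖∫ ω, (f - g : Lp ℝ 2 P) ω ∂P‖ := by
        rw [integral_congr_ae (Lp.coeFn_sub f g)]; rfl
    _ ≤ _ := (norm_integral_le_integral_norm _).trans (integral_norm_le_norm _)

/-- The characteristic function at `t` is `|t|`-Lipschitz in the mean-square norm. -/
lemma continuous_charFun_Lp_two (t : ℝ) :
    Continuous fun f : Lp ℝ 2 P => charFun (P.map f) t := by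
  refine (LipschitzWith.of_dist_le_mul (K := ⟨|t|, abs_nonneg t⟩) fun f g => ?_).continuous
  have hform : ∀ f : Lp ℝ 2 P,
      charFun (P.map f) t = ∫ ω, Complex.exp (Complex.I * ((t * f ω : ℝ) : ℂ)) ∂P := fun f => by
    rw [charFun_apply_real, integral_map (Lp.aestronglyMeasurable f).aemeasurable (by fun_prop)]
    congr 1 with ω
    push_cast; ring_nf
  have hint : ∀ f : Lp ℝ 2 P,
      Integrable (fun ω => Complex.exp (Complex.I * ((t * f ω : ℝ) : ℂ))) P := fun f => by
    refine Integrable.of_bound (C := 1) ?_ (Eventually.of_forall fun ω => ?_)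
    · have := Lp.aestronglyMeasurable f
      fun_prop
    · rw [mul_comm, Complex.norm_exp_ofReal_mul_I]
  rw [dist_eq_norm, dist_eq_norm, hform, hform, ← integral_sub (hint f) (hint g)]
  have hpt : ∀ a b : ℝ, ‖Complex.exp (Complex.I * (a : ℂ)) - Complex.exp (Complex.I * (b : ℂ))‖
      ≤ |a - b| := fun a b => by
    have : Complex.exp (Complex.I * (a : ℂ)) - Complex.exp (Complex.I * (b : ℂ)) =
        Complex.exp ((b : ℂ) * Complex.I) *
          (Complex.exp (Complex.I * ((a - b : ℝ) : ℂ)) - 1) := by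
      rw [mul_sub, ← Complex.exp_add]
      congr 2 <;> push_cast <;> ring_nf
    rw [this, norm_mul, Complex.norm_exp_ofReal_mul_I, one_mul]
    exact Real.norm_exp_I_mul_ofReal_sub_one_le
  have hd : ∫ ω, ‖f ω - g ω‖ ∂P ≤ ‖f - g‖ := by
    refine le_trans (le_of_eq ?_) (integral_norm_le_norm (f - g))
    refine integral_congr_ae ?_
    filter_upwards [Lp.coeFn_sub f g] with ω hω
    rw [hω]; rfl
  calc _ ≤ ∫ ω, |t| * ‖f ω - g ω‖ ∂P := by
        refine norm_integral_le_of_norm_le ?_ (Eventually.of_forall fun ω => ?_)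
        · exact ((((Lp.memLp f).sub (Lp.memLp g)).integrable (by norm_num)).norm).const_mul _
        · refine (hpt _ _).trans_eq ?_
          rw [← mul_sub, abs_mul, Real.norm_eq_abs]
    _ ≤ |t| * ‖f - g‖ := by
        rw [integral_const_mul]
        gcongr
    _ = _ := rfl

/-- For centered variables the variance is the squared norm, which turns Gaussianity into a
condition that is visibly closed in mean square. -/
lemma mem_centeredGaussian_iff {f : Lp ℝ 2 P} : f ∈ centeredGaussian P ↔
    ∫ ω, f ω ∂P = 0 ∧ ∀ t : ℝ, charFun (P.map f) t = Complex.exp (-(‖f‖ ^ 2 * t ^ 2 / 2 : ℝ)) := by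
  have hae := (Lp.aestronglyMeasurable f).aemeasurable
  rw [centeredGaussian, Set.mem_ofPred_eq, and_comm]
  refine and_congr_right fun h0 => ?_
  rw [hasGaussianLaw_iff_charFun_map_eq hae]
  refine forall_congr' fun t => ?_
  have h1 : (fun ω => inner ℝ t (f ω)) = fun ω => t * f ω := by ext ω; simp [mul_comm]
  rw [h1, integral_const_mul, h0, variance_const_mul, variance_of_integral_eq_zero hae h0,
    integral_sq_eq_norm_sq]
  push_cast
  ring_nf

/-- Mean-square limits of centered Gaussian variables are centered Gaussian. -/
lemma isClosed_centeredGaussian : IsClosed (centeredGaussian P) := by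
  have : centeredGaussian P = {f : Lp ℝ 2 P | ∫ ω, f ω ∂P = 0} ∩
      ⋂ t : ℝ, {f | charFun (P.map f) t = Complex.exp (-(‖f‖ ^ 2 * t ^ 2 / 2 : ℝ))} := by
    ext f
    simp [mem_centeredGaussian_iff]
  rw [this]
  refine (isClosed_eq continuous_integral_Lp_two continuous_const).inter
    (isClosed_iInter fun t => isClosed_eq (continuous_charFun_Lp_two t) (by fun_prop))

/-- In a linear space of centered Gaussian variables, orthogonality is independence. -/
lemma indepFun_of_inner_eq_zero {K : Submodule ℝ (Lp ℝ 2 P)}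
    (hK : (K : Set (Lp ℝ 2 P)) ⊆ centeredGaussian P) {T : Type*} {F : T → Lp ℝ 2 P}
    (hF : ∀ t, F t ∈ K) {w : Lp ℝ 2 P} (hw : w ∈ K) (h : ∀ t, inner ℝ w (F t) = 0) :
    IndepFun w (fun ω t => F t ω) P := by
  have hproc := isGaussianProcess_of_subset_centeredGaussian hK
    (F := Sum.elim (fun _ : Unit => w) F) (by rintro (_ | t) <;> simp [hw, hF])
  have hproc' : IsGaussianProcess (Sum.elim (fun (_ : Unit) ω => w ω) fun t ω => F t ω) P := by
    convert hproc using 1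
    ext (_ | t) <;> rfl
  have hind := hproc'.indepFun_of_covariance_eq_zero
    (fun _ => (Lp.aestronglyMeasurable w).aemeasurable)
    (fun t => (Lp.aestronglyMeasurable (F t)).aemeasurable) fun _ t => by
      rw [covariance_eq_sub (Lp.memLp w) (Lp.memLp (F t)), (hK hw).2, zero_mul, sub_zero]
      exact (integral_mul_eq_inner w (F t)).trans (h t)
  exact hind.comp (measurable_pi_apply ()) measurable_id

/-- If the error `Y (t + 1) - p` of a linear prediction `p` is orthogonal to the past, it is
independent of the past by Gaussianity. So `p` is the conditional expectation and the conditional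
variance of the error is its squared norm. -/
lemma hasRootMSFE_of_innovation {K : Submodule ℝ (Lp ℝ 2 P)} (hKc : IsClosed (K : Set (Lp ℝ 2 P)))
    (hK : (K : Set (Lp ℝ 2 P)) ⊆ centeredGaussian P) {Y : ℤ → Lp ℝ 2 P} (hY : ∀ t, Y t ∈ K)
    {X : ℤ → Ω → ℝ} (hX : ∀ t, Measurable (X t)) {c : ℝ} (hXY : ∀ t, X t =ᵐ[P] fun ω => c + Y t ω)
    {σ : ℝ} (hσ : 0 ≤ σ)
    (h : ∀ t, ∃ p ∈ closedPast Y t, ‖Y (t + 1) - p‖ = σ ∧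
      ∀ r ≤ t, inner ℝ (Y (t + 1) - p) (Y r) = 0) :
    HasRootMSFE P X σ := by
  refine ⟨hσ, fun t => ⟨hX t, ((memLp_const c).add (Lp.memLp (Y t))).ae_eq (hXY t).symm⟩,
    fun t => ?_⟩
  obtain ⟨p, hp, hnorm, horth⟩ := h t
  have hle := history_le hX t
  set w := Y (t + 1) - p with hw
  have hpK : p ∈ K := closedPast_le hKc (fun s _ => hY s) hp
  have hpm : AEStronglyMeasurable[history X t] p P := by
    rw [← mem_lpMeas_iff_aestronglyMeasurable (𝕜 := ℝ)]
    refine closedPast_le (K := lpMeas ℝ ℝ (history X t) 2 P) ?_ (fun s hs => ?_) hp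
    · have : Fact (history X t ≤ (inferInstance : MeasurableSpace Ω)) := ⟨hle⟩
      exact (completeSpace_coe_iff_isComplete.1
        (inferInstanceAs (CompleteSpace (lpMeas ℝ ℝ (history X t) 2 P)))).isClosed
    · rw [mem_lpMeas_iff_aestronglyMeasurable]
      refine ⟨fun ω => X s ω - c, ((measurable_history X hs).sub_const c).stronglyMeasurable, ?_⟩
      filter_upwards [hXY s] with ω hω
      rw [hω]; ring
  have hind : Indep (MeasurableSpace.comap w inferInstance) (history X t) P := by
    have h1 := indepFun_of_inner_eq_zero hK (fun s : Set.Iic t => hY s) (K.sub_mem (hY _) hpK)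
      (fun s => horth s s.2)
    have h2 : IndepFun w (fun ω (s : Set.Iic t) => c + Y s ω) P :=
      h1.comp (φ := id) (ψ := fun (v : Set.Iic t → ℝ) s => c + v s) measurable_id
        (measurable_pi_lambda _ fun s => measurable_const.add (measurable_pi_apply s))
    have h3 : IndepFun w (fun ω (s : Set.Iic t) => X s ω) P := by
      refine h2.congr (ae_eq_refl _) ?_
      filter_upwards [ae_all_iff.2 hXY] with ω hω
      ext s
      exact (hω s).symm
    rw [IndepFun_iff_Indep, MeasurableSpace.comap_process_pi] at h3
    rwa [history, iSup_subtype']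
  have hwm : StronglyMeasurable w := Lp.stronglyMeasurable w
  have hw1 : P[w | history X t] =ᵐ[P] fun _ => 0 := by
    have := condExp_indep_eq hwm.measurable.comap_le hle
      (comap_measurable w).stronglyMeasurable hind
    rwa [(hK (K.sub_mem (hY _) hpK)).2] at this
  have hw2 : P[fun ω => w ω ^ 2 | history X t] =ᵐ[P] fun _ => σ ^ 2 := by
    have := condExp_indep_eq hwm.measurable.comap_le hle
      ((comap_measurable w).pow_const 2).stronglyMeasurable hind
    rwa [integral_sq_eq_norm_sq, hnorm] at this
  have hint : ∀ f : Lp ℝ 2 P, Integrable f P := fun f => (Lp.memLp f).integrable (by norm_num)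
  have hpred : P[X (t + 1) | history X t] =ᵐ[P] fun ω => c + p ω := by
    have h1 : X (t + 1) =ᵐ[P] (fun ω => c + p ω) + w := by
      filter_upwards [hXY (t + 1), Lp.coeFn_sub (Y (t + 1)) p] with ω h1 h2
      rw [h1, Pi.add_apply, hw, h2, Pi.sub_apply]; ring
    have hcp : Integrable (fun ω => c + p ω) P := (integrable_const c).add (hint p)
    have h2 : P[fun ω => c + p ω | history X t] =ᵐ[P] fun ω => c + p ω :=
      condExp_of_aestronglyMeasurable' hle (aestronglyMeasurable_const.add hpm) hcp
    filter_upwards [condExp_congr_ae h1 (m := history X t),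
      condExp_add hcp (hint w) (history X t), h2, hw1] with ω h1 h3 h2 hw1
    rw [h1, h3, Pi.add_apply, h2, hw1, add_zero]
  have herr : X (t + 1) - P[X (t + 1) | history X t] =ᵐ[P] w := by
    filter_upwards [hpred, hXY (t + 1), Lp.coeFn_sub (Y (t + 1)) p] with ω h1 h2 h3
    rw [Pi.sub_apply, h1, h2, hw, h3, Pi.sub_apply]; ring
  refine (condVar_congr_ae herr).trans ((condExp_congr_ae ?_).trans hw2)
  filter_upwards [hw1] with ω h1
  simp [h1]

end GaussianSpace

/-! ### Gaussian white noise -/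

section WhiteNoise

variable {Ω : Type*} [MeasurableSpace Ω] {P : Measure Ω} {ε : ℤ → Ω → ℝ}

namespace IsGaussianWhiteNoise

lemma hasGaussianLaw (h : IsGaussianWhiteNoise P ε) (t : ℤ) : HasGaussianLaw (ε t) P :=
  ⟨by rw [h.law t]; infer_instance⟩

lemma memLp (h : IsGaussianWhiteNoise P ε) (t : ℤ) : MemLp (ε t) 2 P :=
  (h.hasGaussianLaw t).memLp_two

lemma integral_eq_zero (h : IsGaussianWhiteNoise P ε) (t : ℤ) : ∫ ω, ε t ω ∂P = 0 := by
  have := integral_map (μ := P) (h.measurable t).aemeasurable (f := fun x : ℝ => x) (by fun_prop)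
  rw [← this, h.law t, integral_id_gaussianReal]

lemma orthonormal (h : IsGaussianWhiteNoise P ε) :
    Orthonormal ℝ fun t => (h.memLp t).toLp (ε t) := by
  have hinner : ∀ s t, inner ℝ ((h.memLp s).toLp (ε s)) ((h.memLp t).toLp (ε t)) =
      ∫ ω, ε s ω * ε t ω ∂P := fun s t => by
    rw [← integral_mul_eq_inner]
    refine integral_congr_ae ?_
    filter_upwards [(h.memLp s).coeFn_toLp, (h.memLp t).coeFn_toLp] with ω h1 h2
    rw [h1, h2]
  refine ⟨fun t => ?_, fun s t hst => ?_⟩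
  · have h1 := integral_map (μ := P) (h.measurable t).aemeasurable (f := fun x : ℝ => x ^ 2)
      (by fun_prop)
    have h2 : ∫ x, x ^ 2 ∂(gaussianReal 0 1) = 1 := by
      rw [← variance_of_integral_eq_zero (by fun_prop) integral_id_gaussianReal]
      simp
    have h3 := hinner t t
    rw [real_inner_self_eq_norm_sq] at h3
    simp_rw [← pow_two] at h3
    rw [← h1, h.law t, h2] at h3
    exact (pow_eq_one_iff_of_nonneg (norm_nonneg _) two_ne_zero).1 h3
  · refine (hinner s t).trans ?_
    rw [(h.indep.indepFun hst).integral_fun_mul_eq_mul_integral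
      (h.measurable s).aestronglyMeasurable (h.measurable t).aestronglyMeasurable,
      h.integral_eq_zero, zero_mul]

variable [IsProbabilityMeasure P]

/-- The Gaussian Hilbert space of the white noise: finite linear combinations of the shocks are
Gaussian by independence, and mean-square limits stay Gaussian. -/
lemma span_subset_centeredGaussian (h : IsGaussianWhiteNoise P ε) :
    ((Submodule.span ℝ (Set.range fun t => (h.memLp t).toLp (ε t))).topologicalClosure :
      Set (Lp ℝ 2 P)) ⊆ centeredGaussian P := by
  refine closure_minimal (fun f hf => ?_) isClosed_centeredGaussian
  obtain ⟨c, rfl⟩ := Finsupp.mem_span_range_iff_exists_finsupp.1 hf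
  have hjoint : HasGaussianLaw (fun ω (i : c.support) => ε i ω) P :=
    iIndepFun.hasGaussianLaw (fun i => h.hasGaussianLaw i)
      (h.indep.precomp Subtype.val_injective)
  let L : (c.support → ℝ) →L[ℝ] ℝ := ∑ i : c.support, c i • ContinuousLinearMap.proj i
  have hL : (fun ω => L fun i : c.support => ε i ω) =ᵐ[P]
      (c.sum fun i b => b • (h.memLp i).toLp (ε i) : Lp ℝ 2 P) := by
    filter_upwards [coeFn_sum_smul c.support c fun i => (h.memLp i).coeFn_toLp] with ω h
    refine Eq.trans ?_ h.symm
    rw [← Finset.sum_coe_sort]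
    simp [L]
  refine ⟨(hjoint.map_fun L).congr hL, ?_⟩
  rw [← integral_congr_ae hL]
  simp only [L, sum_apply, smul_apply,
    ContinuousLinearMap.proj_apply, smul_eq_mul]
  rw [integral_finsetSum]
  · simp [integral_const_mul, h.integral_eq_zero]
  · exact fun i _ => ((h.memLp i).integrable (by norm_num)).const_mul _

end IsGaussianWhiteNoise

lemma MeanSquareSum.memLp {f : ℕ → Ω → ℝ} {S : Ω → ℝ} (h : MeanSquareSum P f S)
    (hf : ∀ k, MemLp (f k) 2 P) (hS : AEStronglyMeasurable S P) : MemLp S 2 P := by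
  -- one partial sum at finite mean-square distance from `S` is enough
  obtain ⟨m, hm⟩ := (h.eventually (gt_mem_nhds (zero_lt_one' ℝ≥0∞))).exists
  have hsum : MemLp (fun ω => ∑ k ∈ Finset.range m, f k ω) 2 P := memLp_finsetSum _ fun k _ => hf k
  have h1 : MemLp (fun ω => S ω - ∑ k ∈ Finset.range m, f k ω) 2 P :=
    ⟨hS.sub hsum.1, hm.trans ENNReal.one_lt_top⟩
  convert! h1.add hsum using 1
  ext ω; simp

end WhiteNoise

/-! ### The `z`-transform -/

section Transform

/-- `zTransform a` as a power series on the unit disk. -/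
lemma hasFPowerSeriesAt_zTransform {a : ℕ → ℝ} (ha : Summable fun k => a k ^ 2) :
    HasFPowerSeriesAt (zTransform a)
      (FormalMultilinearSeries.ofScalars ℂ fun k => (a k : ℂ)) 0 := by
  set p := FormalMultilinearSeries.ofScalars ℂ fun k => (a k : ℂ) with hp
  have hrad : 0 < p.radius := by
    have hb : ∀ n, ‖p n‖ * ((1 : NNReal) : ℝ) ^ n ≤ ∑' k, a k ^ 2 + 1 := fun n => by
      have h1 : a n ^ 2 ≤ ∑' k, a k ^ 2 := ha.le_tsum n fun _ _ => sq_nonneg _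
      have h2 : |a n| ≤ a n ^ 2 + 1 := by
        rw [← sq_abs]; nlinarith [sq_nonneg (|a n| - 1), abs_nonneg (a n)]
      have h3 : ‖p n‖ = |a n| := by
        simp [hp]
      simp only [h3, NNReal.coe_one, one_pow, mul_one]
      linarith
    exact lt_of_lt_of_le (by simp) (p.le_radius_of_bound _ hb)
  have h := (p.hasFPowerSeriesOnBall hrad).hasFPowerSeriesAt
  have hsum : p.sum = zTransform a := by
    ext z
    simp [hp, zTransform, FormalMultilinearSeries.sum, smul_eq_mul, mul_comm]
  rwa [hsum] at h

lemma zTransform_zero (a : ℕ → ℝ) : zTransform a 0 = a 0 := by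
  rw [zTransform, tsum_eq_single 0 (by intro k hk; simp [hk])]
  simp

/-- A square-summable sequence is determined by its `z`-transform times a fixed transform with
nonzero constant term. -/
lemma eq_of_zTransform_mul_eq {a b ψ : ℕ → ℝ} (ha : Summable fun k => a k ^ 2)
    (hb : Summable fun k => b k ^ 2) (hψ : Summable fun k => ψ k ^ 2) (h0 : ψ 0 ≠ 0)
    (h : ∀ z : ℂ, ‖z‖ < 1 → zTransform a z * zTransform ψ z = zTransform b z * zTransform ψ z) :
    a = b := by
  have hne : ∀ᶠ z in 𝓝 (0 : ℂ), zTransform ψ z ≠ 0 := by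
    refine (hasFPowerSeriesAt_zTransform hψ).continuousAt.eventually_ne ?_
    rw [zTransform_zero]
    exact_mod_cast h0
  have heq : zTransform a =ᶠ[𝓝 0] zTransform b := by
    filter_upwards [hne, Metric.ball_mem_nhds (0 : ℂ) one_pos] with z hz hz1
    exact mul_right_cancel₀ hz (h z (by simpa using hz1))
  have hser := ((hasFPowerSeriesAt_zTransform ha).congr heq).eq_formalMultilinearSeries
    (hasFPowerSeriesAt_zTransform hb)
  ext k
  have := congrArg (fun p => p.coeff k) hser
  simpa using this

/-- The filter with transfer function `a + b z`. -/
def twoTermFilter (a b : ℝ) : ℕ → ℝ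
  | 0 => a
  | 1 => b
  | _ + 2 => 0

lemma twoTermFilter_eq_zero (a b : ℝ) {k : ℕ} (hk : k ∉ Finset.range 2) :
    twoTermFilter a b k = 0 := by
  obtain ⟨j, rfl⟩ := Nat.exists_eq_add_of_le' (not_lt.1 fun h => hk (Finset.mem_range.2 h))
  rfl

lemma summable_twoTermFilter_sq (a b : ℝ) : Summable fun k => twoTermFilter a b k ^ 2 :=
  summable_of_ne_finset_zero (s := Finset.range 2) fun k hk => by
    simp [twoTermFilter_eq_zero a b hk]

lemma zTransform_twoTermFilter (a b : ℝ) (z : ℂ) :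
    zTransform (twoTermFilter a b) z = a + b * z := by
  rw [zTransform, tsum_eq_sum (s := Finset.range 2) fun k hk => by
    simp [twoTermFilter_eq_zero a b hk]]
  simp [Finset.sum_range_succ, twoTermFilter]

lemma meanSquareSum_twoTermFilter_iff {Ω : Type*} [MeasurableSpace Ω] {P : Measure Ω} {a b : ℝ}
    {Z : ℕ → Ω → ℝ} {S : Ω → ℝ} (hZ : ∀ k, Measurable (Z k)) (hS : Measurable S) :
    MeanSquareSum P (fun k ω => twoTermFilter a b k * Z k ω) S ↔
      S =ᵐ[P] fun ω => a * Z 0 ω + b * Z 1 ω := by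
  have hconst : (fun m : ℕ => eLpNorm (fun ω => S ω -
      ∑ k ∈ Finset.range m, twoTermFilter a b k * Z k ω) 2 P) =ᶠ[atTop]
      fun _ => eLpNorm (S - fun ω => a * Z 0 ω + b * Z 1 ω) 2 P := by
    filter_upwards [eventually_ge_atTop 2] with m hm
    congr 1
    ext ω
    rw [Pi.sub_apply, ← Finset.sum_subset (Finset.range_mono hm) fun _ _ hk => by
      rw [twoTermFilter_eq_zero a b hk, zero_mul]]
    simp [Finset.sum_range_succ, twoTermFilter]
  have hmeas : Measurable (S - fun ω => a * Z 0 ω + b * Z 1 ω) :=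
    hS.sub (((hZ 0).const_mul a).add ((hZ 1).const_mul b))
  rw [MeanSquareSum, tendsto_congr' hconst, tendsto_const_nhds_iff,
    eLpNorm_eq_zero_iff hmeas.aestronglyMeasurable (by norm_num), sub_ae_eq_zero]

end Transform

/-! ### Demand and allocation policies -/

section Allocation

/-- The transforms of an alternating policy determine its filters. -/
lemma isAlternatingPolicy_iff {ψ : ℕ → ℝ} (hψ : Summable fun k => ψ k ^ 2) (h0 : ψ 0 ≠ 0)
    {N : ℕ} {μ α : ℝ} (π : AllocationPolicy N) :
    IsAlternatingPolicy μ ψ α π ↔ ∀ i : Fin N, π.mean i = μ / N ∧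
      π.filter i = twoTermFilter (1 / N) ((-1) ^ ((i : ℕ) + 1) * α / N) := by
  refine forall_congr' fun i => and_congr_right fun _ => ?_
  have hform : ∀ z : ℂ, zTransform ψ z / N * (1 + (-1) ^ ((i : ℕ) + 1) * (α : ℂ) * z) =
      zTransform (twoTermFilter (1 / N) ((-1) ^ ((i : ℕ) + 1) * α / N)) z * zTransform ψ z :=
    fun z => by
      rw [zTransform_twoTermFilter]
      push_cast
      ring
  refine ⟨fun h => ?_, fun h z _ => ?_⟩
  · refine eq_of_zTransform_mul_eq (π.sq_summable i) (summable_twoTermFilter_sq _ _) hψ h0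
      fun z hz => ?_
    rw [← hform, ← h z hz, sellerTransform]
  · rw [sellerTransform, hform, h]

lemma sum_alternating {N : ℕ} (hN : Even N) : ∑ i : Fin N, (-1 : ℝ) ^ ((i : ℕ) + 1) = 0 := by
  rw [Fin.sum_univ_eq_sum_range fun i => (-1 : ℝ) ^ (i + 1)]
  simp_rw [pow_succ, ← Finset.sum_mul]
  rw [neg_one_geom_sum, if_pos hN, zero_mul]

variable {Ω : Type*} [MeasurableSpace Ω] {P : Measure Ω} {μ : ℝ} {ψ : ℕ → ℝ}
  {ε D : ℤ → Ω → ℝ} {N : ℕ} {π : AllocationPolicy N}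

lemma isSellerDemand_iff (hD : ∀ t, Measurable (D t)) {n : Fin N} {b : ℝ}
    (hmean : π.mean n = μ / N) (hfil : π.filter n = twoTermFilter (1 / N) (b / N))
    {X : ℤ → Ω → ℝ} :
    IsSellerDemand P μ D π n X ↔ (∀ t, Measurable (X t)) ∧ ∀ t, X t =ᵐ[P] fun ω =>
      μ / N + 1 / N * ((D t ω - μ) + b * (D (t - 1) ω - μ)) := by
  have key : (∀ t, Measurable (X t)) → ∀ t : ℤ,
      MeanSquareSum P (fun k ω => π.filter n k * (D (t - k) ω - μ)) (fun ω => X t ω - π.mean n) ↔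
      X t =ᵐ[P] fun ω => μ / N + 1 / N * ((D t ω - μ) + b * (D (t - 1) ω - μ)) := fun hX t => by
    rw [hfil, hmean, meanSquareSum_twoTermFilter_iff (Z := fun k ω => D (t - k) ω - μ)
      (fun k => (hD _).sub_const μ) ((hX t).sub_const _)]
    refine ⟨fun h => ?_, fun h => ?_⟩ <;> filter_upwards [h] with ω h
    · have := sub_eq_iff_eq_add.1 h
      rw [this]; simp; ring
    · rw [h]; simp; ring
  exact ⟨fun h => ⟨h.1, fun t => (key h.1 t).1 (h.2 t)⟩,
    fun h => ⟨h.1, fun t => (key h.1 t).2 (h.2 t)⟩⟩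

namespace IsMarketDemand

lemma measurable_sub (hD : IsMarketDemand P μ ψ ε D) (t : ℤ) : Measurable fun ω => D t ω - μ :=
  (hD.measurable t).sub_const μ

lemma memLp (hD : IsMarketDemand P μ ψ ε D) (t : ℤ) : MemLp (fun ω => D t ω - μ) 2 P :=
  (hD.movingAverage t).memLp (fun _ => (hD.whiteNoise.memLp _).const_mul _)
    (hD.measurable_sub t).aestronglyMeasurable

lemma isMovingAverage (hD : IsMarketDemand P μ ψ ε D) :
    IsMovingAverage ψ (fun t => (hD.whiteNoise.memLp t).toLp (ε t))
      (fun t => (hD.memLp t).toLp _) := fun t => by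
  rw [Lp.tendsto_Lp_iff_tendsto_eLpNorm']
  refine (hD.movingAverage t).congr fun m => ?_
  rw [eLpNorm_sub_comm]
  refine eLpNorm_congr_ae ?_
  filter_upwards [(hD.memLp t).coeFn_toLp, coeFn_sum_smul (Finset.range m) ψ
    fun k : ℕ => (hD.whiteNoise.memLp (t - k)).coeFn_toLp] with ω h1 h2
  rw [Pi.sub_apply, h1, h2]

lemma shock_mem_closedPast (hD : IsMarketDemand P μ ψ ε D) (t : ℤ) :
    (hD.whiteNoise.memLp t).toLp (ε t) ∈ closedPast (fun t => (hD.memLp t).toLp _) t := by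
  refine Metric.mem_closure_iff.2 fun η hη => ?_
  obtain ⟨m, c, hc⟩ := hD.invertible t (ENNReal.ofReal η) (ENNReal.ofReal_pos.2 hη)
  refine ⟨∑ k ∈ Finset.range m, c k • (hD.memLp (t - k)).toLp _,
    Submodule.sum_mem _ fun k _ => Submodule.smul_mem _ _
      (Submodule.subset_span ⟨t - k, by simp, rfl⟩), ?_⟩
  rw [Lp.dist_def, ← ENNReal.toReal_ofReal hη.le,
    ENNReal.toReal_lt_toReal ((Lp.memLp _).sub (Lp.memLp _)).2.ne ENNReal.ofReal_ne_top]
  refine (eLpNorm_congr_ae ?_).trans_lt hc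
  filter_upwards [(hD.whiteNoise.memLp t).coeFn_toLp, coeFn_sum_smul (Finset.range m) c
    fun k : ℕ => (hD.memLp (t - k)).coeFn_toLp] with ω h1 h2
  rw [Pi.sub_apply, h1, h2]

lemma leading_ne_zero (hD : IsMarketDemand P μ ψ ε D) : ψ 0 ≠ 0 :=
  hD.isMovingAverage.leading_ne_zero hD.whiteNoise.orthonormal hD.shock_mem_closedPast

variable [IsProbabilityMeasure P]

/-- The one-step forecast error of `κ (D t - μ + s α (D (t - 1) - μ))`, with `s = ±1`
and `α > 1`. The zero `-s / α` of `1 + s α z` lies inside the unit disk; reflecting it replaces this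
factor by `α + s z`, whence the factor `α` in the error. -/
lemma hasRootMSFE_of_two_term (hD : IsMarketDemand P μ ψ ε D) {s α : ℝ} (hs : s ^ 2 = 1)
    (hα : 1 < α) (c κ : ℝ) {X : ℤ → Ω → ℝ} (hX : ∀ t, Measurable (X t))
    (hXD : ∀ t, X t =ᵐ[P] fun ω => c + κ * ((D t ω - μ) + s * α * (D (t - 1) ω - μ))) :
    HasRootMSFE P X (|κ| * α * |ψ 0|) := by
  let E : ℤ → Lp ℝ 2 P := fun t => (hD.whiteNoise.memLp t).toLp (ε t)
  let d : ℤ → Lp ℝ 2 P := fun t => (hD.memLp t).toLp _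
  let K : Submodule ℝ (Lp ℝ 2 P) := (Submodule.span ℝ (Set.range E)).topologicalClosure
  have hKc : IsClosed (K : Set (Lp ℝ 2 P)) := Submodule.isClosed_topologicalClosure _
  have hdK : ∀ t, d t ∈ K := fun t =>
    closedPast_le hKc
      (fun r _ => Submodule.le_topologicalClosure _ (Submodule.subset_span ⟨r, rfl⟩))
      (hD.isMovingAverage.mem_closedPast t)
  have hα0 : 0 < α := by linarith
  refine hasRootMSFE_of_innovation (Y := fun t => κ • (d t + (s * α) • d (t - 1))) (c := c) hKc
    hD.whiteNoise.span_subset_centeredGaussian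
    (fun t => K.smul_mem _ (K.add_mem (hdK t) (K.smul_mem _ (hdK _)))) hX (fun t => ?_)
    (by positivity)
    (exists_innovation_of_orthonormal hD.whiteNoise.orthonormal hD.isMovingAverage
      hD.shock_mem_closedPast hs hα κ fun _ => rfl)
  filter_upwards [hXD t, Lp.coeFn_smul κ (d t + (s * α) • d (t - 1)),
    Lp.coeFn_add (d t) ((s * α) • d (t - 1)), Lp.coeFn_smul (s * α) (d (t - 1)),
    (hD.memLp t).coeFn_toLp, (hD.memLp (t - 1)).coeFn_toLp] with ω h1 h2 h3 h4 h5 h6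
  rw [h1, h2, Pi.smul_apply, h3, Pi.add_apply, h4, Pi.smul_apply, h5, h6]
  simp only [smul_eq_mul]

end IsMarketDemand

end Allocation

theorem proposition3 {Ω : Type*} [MeasurableSpace Ω] (P : Measure Ω) [IsProbabilityMeasure P]
    (μ : ℝ) (ψ : ℕ → ℝ) (ε D : ℤ → Ω → ℝ) (hD : IsMarketDemand P μ ψ ε D)
    (N : ℕ) (hN : 0 < N) (hEven : Even N) (σ : ℝ) (hσ : sigmaL ψ N < σ) :
    (∃ π : AllocationPolicy N, IsAlternatingPolicy μ ψ (σ / sigmaL ψ N) π) ∧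
      ∀ π : AllocationPolicy N, IsAlternatingPolicy μ ψ (σ / sigmaL ψ N) π →
        IsAdmissible P μ D π ∧ IsNeutral P μ D π ∧ ∀ n, SellerHasRootMSFE P μ D π n σ := by
  have h0 : ψ 0 ≠ 0 := hD.leading_ne_zero
  have hN0 : (0 : ℝ) < N := by exact_mod_cast hN
  have hL : 0 < sigmaL ψ N := div_pos (abs_pos.2 h0) hN0
  have hσ0 : 0 < σ := hL.trans hσ
  set α := σ / sigmaL ψ N with hα_def
  have hα : 1 < α := (one_lt_div hL).2 hσ
  have hiff := isAlternatingPolicy_iff (μ := μ) (α := α) (N := N) hD.sq_summable h0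
  refine ⟨⟨⟨fun _ => μ / N, fun i => twoTermFilter (1 / N) ((-1) ^ ((i : ℕ) + 1) * α / N),
    fun i => summable_twoTermFilter_sq _ _⟩, (hiff _).2 fun _ => ⟨rfl, rfl⟩⟩, fun π hπ => ?_⟩
  have hdem : ∀ n X, IsSellerDemand P μ D π n X ↔ (∀ t, Measurable (X t)) ∧ ∀ t, X t =ᵐ[P] fun ω =>
      μ / N + 1 / N * ((D t ω - μ) + (-1) ^ ((n : ℕ) + 1) * α * (D (t - 1) ω - μ)) := fun n X =>
    isSellerDemand_iff hD.measurable ((hiff π).1 hπ n).1 ((hiff π).1 hπ n).2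
  have hex : ∀ n, ∃ X, IsSellerDemand P μ D π n X := fun n =>
    ⟨_, (hdem n _).2 ⟨fun t => (((hD.measurable_sub t).add
      ((hD.measurable_sub (t - 1)).const_mul _)).const_mul _).const_add _, fun t => ae_eq_refl _⟩⟩
  have hmsfe : ∀ n, SellerHasRootMSFE P μ D π n σ := fun n => by
    refine ⟨hex n, fun X hX => ?_⟩
    have h := hD.hasRootMSFE_of_two_term (s := (-1) ^ ((n : ℕ) + 1))
      (by rw [← pow_mul, mul_comm, pow_mul]; norm_num) hα (μ / N) (1 / N)
      ((hdem n X).1 hX).1 ((hdem n X).1 hX).2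
    convert h using 1
    rw [abs_of_pos (by positivity), hα_def, sigmaL]
    field_simp
  have hadm : IsAdmissible P μ D π := by
    refine ⟨hex, ?_, fun z _ => ?_, fun X hX t => ?_⟩
    · simp only [fun n => ((hiff π).1 hπ n).1]
      simp [mul_div_cancel₀, hN0.ne']
    · have hsum := congrArg ((↑) : ℝ → ℂ) (sum_alternating hEven)
      push_cast at hsum
      simp only [fun n => ((hiff π).1 hπ n).2, zTransform_twoTermFilter]
      push_cast
      simp_rw [Finset.sum_add_distrib, mul_div_assoc, mul_assoc, ← Finset.sum_mul, hsum]
      have : (N : ℂ) ≠ 0 := by exact_mod_cast hN.ne'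
      simp [this]
    · filter_upwards [ae_all_iff.2 fun n => ((hdem n _).1 (hX n)).2 t] with ω h
      simp only [h]
      simp_rw [Finset.sum_add_distrib, ← Finset.mul_sum, Finset.sum_add_distrib, mul_assoc,
        ← Finset.sum_mul, sum_alternating hEven]
      simp only [Finset.sum_const, Finset.card_univ, Fintype.card_fin, nsmul_eq_mul, zero_mul,
        add_zero]
      field_simp
      ring
  exact ⟨hadm, ⟨hadm, σ, hσ0, fun n => ⟨((hiff π).1 hπ n).1, hmsfe n⟩⟩, hmsfe⟩
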